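/- For integers $k \ge 2$ and $n \ge 1$, let $r_k(n)$ denote the two-colour hypergraph Ramsey number, i.e. the least $N$ such that for every $2$-colouring of the $k$-element subsets of an $N$-element set there is a subset of size $n$ all of whose $k$-element subsets have the same colour. Let the tower function $t_i(x)$ be defined for real $x$ by $t_1(x) = x$ and $t_{i+1}(x) = 2^{t_i(x)}$. Then there is an absolute constant $c > 0$ such that for all integers $k \ge 2$ and $n \ge 3k$, $$r_k(n) \ge t_{k-1}(c n^2).$$ -/

import Mathlib

namespace HypergraphRamsey

/-- The partition relation `N → (n)_ℓ^k`: for every coloring of the `k`-element subsets of an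
`N`-element set with `ℓ` colors there is a set of size `n` all of whose `k`-element subsets
have the same color. -/
def Arrows (N n k ℓ : ℕ) : Prop :=
  ∀ χ : {e : Finset (Fin N) // e.card = k} → Fin ℓ,
    ∃ S : Finset (Fin N), S.card = n ∧
      ∃ i : Fin ℓ, ∀ e : {e : Finset (Fin N) // e.card = k}, e.1 ⊆ S → χ e = i

/-- The two-color Ramsey number `r_k(n)`: the least `N` such that `N → (n)_2^k`. -/
noncomputable def ramseyNumber (k n : ℕ) : ℕ :=
  sInf {N : ℕ | Arrows N n k 2}

/-- The tower function: `t_1(x) = x` and `t_{i+1}(x) = 2 ^ t_i(x)`.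
The value at index `0` is a convention and is never used. -/
noncomputable def tower : ℕ → ℝ → ℝ
  | 0, x => x
  | 1, x => x
  | (i + 2), x => (2 : ℝ) ^ tower (i + 1) x

end HypergraphRamsey

/-!
The lower bound comes from a stepping-up construction which loses only `5 / 2` on average in the
size of the homogeneous set for each exponential gained. Since `n ≥ 3 k`, after descending from
uniformity `k` to uniformity `4` at least `n / 6` of the size is left, and one last (lossy) step
leads to triples, where the counting bound of Erdős gives `2 ^ (c n ^ 2)`.

*Stepping up.* The vertices are the numbers below `2 ^ N`, and `delta a b` is the position of the
highest binary digit in which `a` and `b` differ. An increasing sequence `v 0 < v 1 < ⋯` has the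
consecutive deltas `d i = delta (v i) (v (i + 1))`, neighbouring deltas are distinct, and
`delta (v i) (v j)` is the largest of `d i, …, d (j - 1)`. Record by the word `stepWord v` whether
`d` goes up or down at each place. A `(k + 1)`-set whose word is constant has `k` distinct deltas,
and is colored like the set of its deltas. A `(k + 1)`-set whose word is not constant is colored by
the first letter of the word, switched when the position of the first turn is odd.

Suppose that `S` is homogeneous, and look at sets of `k + 1` consecutive elements of `S`, that is,
at windows of length `K = k - 1` in the word of `S`. Shifting a window by one place moves a first
turn which is not at the very start of the window one place forward and so changes the color. When
`K ≥ 3` this leaves only words which are constant apart from their first and last letters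
(`run_of_turnColor_eq`), and when `K` is even the two exceptions cannot occur together
(`forcesRun_sub_one`). So `S` contains a long run along which the deltas are monotone, every `k`-set
of deltas in that run comes from a `(k + 1)`-subset of `S` (`exists_lift_of_monotone`), and a good
coloring for uniformity `k` is contradicted (`Avoids.stepUp`). The loss is `3` for even `k ≥ 4` and
`2` for odd `k ≥ 5`; for `k = 3` the size is doubled.

Since `ramseyNumber` is an infimum of natural numbers, which is `0` for the empty set, the finite
Ramsey theorem is needed as well (`exists_bound_ramsey`).
-/

namespace HypergraphRamsey

/-! ### Colorings without homogeneous sets -/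

/-- The negative partition relation `N ↛ (n)_2^k`, for the vertex set `{0, …, N - 1}`: some
coloring has no `n`-set all of whose `k`-subsets have the same color. For convenience every finite
set of naturals gets a color; only those of the `k`-subsets matter. -/
def Avoids (N n k : ℕ) : Prop :=
  ∃ χ : Finset ℕ → Bool, ∀ S ⊆ Finset.range N, S.card = n →
    ∀ b : Bool, ∃ e ⊆ S, e.card = k ∧ χ e ≠ b

theorem Avoids.mono {N n n' k : ℕ} (h : Avoids N n k) (hn : n ≤ n') : Avoids N n' k := by
  obtain ⟨χ, hχ⟩ := h
  refine ⟨χ, fun S hS hcard b => ?_⟩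
  obtain ⟨T, hTS, hT⟩ := Finset.exists_subset_card_eq (hn.trans hcard.ge)
  obtain ⟨e, heT, he⟩ := hχ T (hTS.trans hS) hT b
  exact ⟨e, heT.trans hTS, he⟩

/-! ### The finite Ramsey theorem -/

/-- Ramsey's theorem in its off-diagonal form, proved through the recursion
`R_{k+1}(a + 1, b + 1) ≤ R_k(R_{k+1}(a, b + 1), R_{k+1}(a + 1, b)) + 1`. -/
theorem exists_bound_ramsey (k a b : ℕ) : ∃ N : ℕ, ∀ (α : Type) [DecidableEq α] (V : Finset α),
    N ≤ V.card → ∀ χ : Finset α → Prop,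
      (∃ S ⊆ V, S.card = a ∧ ∀ e ⊆ S, e.card = k → χ e) ∨
      (∃ S ⊆ V, S.card = b ∧ ∀ e ⊆ S, e.card = k → ¬ χ e) := by
  induction k generalizing a b with
  | zero =>
    refine ⟨max a b, fun α _ V hV χ => ?_⟩
    obtain ⟨A, hAV, hA⟩ := Finset.exists_subset_card_eq ((le_max_left a b).trans hV)
    obtain ⟨B, hBV, hB⟩ := Finset.exists_subset_card_eq ((le_max_right a b).trans hV)
    by_cases h : χ ∅
    · exact Or.inl ⟨A, hAV, hA, fun e _ he => by rwa [Finset.card_eq_zero.mp he]⟩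
    · exact Or.inr ⟨B, hBV, hB, fun e _ he => by rwa [Finset.card_eq_zero.mp he]⟩
  | succ k ihk =>
    have hempty : ∀ {α : Type} {e : Finset α}, e ⊆ ∅ → e.card ≠ k + 1 := by
      intro α e he
      simp [Finset.subset_empty.mp he]
    induction a generalizing b with
    | zero =>
      exact ⟨0, fun α _ V _ χ => Or.inl ⟨∅, by simp, rfl, fun e he h => (hempty he h).elim⟩⟩
    | succ a iha =>
      induction b with
      | zero =>
        exact ⟨0, fun α _ V _ χ => Or.inr ⟨∅, by simp, rfl, fun e he h => (hempty he h).elim⟩⟩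
      | succ b ihb =>
        obtain ⟨p, hp⟩ := iha (b + 1)
        obtain ⟨q, hq⟩ := ihb
        obtain ⟨N, hN⟩ := ihk p q
        refine ⟨N + 1, fun α _ V hV χ => ?_⟩
        obtain ⟨v, hv⟩ : V.Nonempty := Finset.card_pos.mp (by omega)
        have hcard : N ≤ (V.erase v).card := by rw [Finset.card_erase_of_mem hv]; omega
        -- If the link of `v` is homogeneous on `S`, then `v` extends a homogeneous subset of `S`.
        have hlink : ∀ (Q : Finset α → Prop) (c : ℕ) (S T : Finset α), S ⊆ V.erase v → T ⊆ S →
            T.card = c → (∀ e ⊆ S, e.card = k → Q (insert v e)) →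
            (∀ e ⊆ T, e.card = k + 1 → Q e) →
            ∃ S ⊆ V, S.card = c + 1 ∧ ∀ e ⊆ S, e.card = k + 1 → Q e := by
          intro Q c S T hS hTS hT h1 h2
          have hvT : v ∉ T := fun h => by simpa using hS (hTS h)
          refine ⟨insert v T, ?_, by rw [Finset.card_insert_of_notMem hvT, hT], ?_⟩
          · exact Finset.insert_subset hv ((hTS.trans hS).trans (Finset.erase_subset _ _))
          · intro e he hek
            by_cases hve : v ∈ e
            · rw [← Finset.insert_erase hve]
              refine h1 _ (fun x hx => hTS ?_) (by rw [Finset.card_erase_of_mem hve]; omega)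
              have := he (Finset.mem_of_mem_erase hx)
              exact (Finset.mem_insert.mp this).resolve_left (Finset.ne_of_mem_erase hx)
            · exact h2 e (fun x hx => (Finset.mem_insert.mp (he hx)).resolve_left
                (fun h => hve (h ▸ hx))) hek
        rcases hN α (V.erase v) hcard (fun e => χ (insert v e)) with
          ⟨S, hS, hSc, h1⟩ | ⟨S, hS, hSc, h1⟩
        · rcases hp α S hSc.ge χ with ⟨T, hTS, hT, h2⟩ | ⟨T, hTS, hT, h2⟩
          · exact Or.inl (hlink χ a S T hS hTS hT h1 h2)
          · exact Or.inr ⟨T, (hTS.trans hS).trans (Finset.erase_subset _ _), hT, h2⟩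
        · rcases hq α S hSc.ge χ with ⟨T, hTS, hT, h2⟩ | ⟨T, hTS, hT, h2⟩
          · exact Or.inl ⟨T, (hTS.trans hS).trans (Finset.erase_subset _ _), hT, h2⟩
          · exact Or.inr (hlink (fun e => ¬ χ e) b S T hS hTS hT h1 h2)

/-! ### The counting bound -/

/-- The union bound of Erdős. A coloring is encoded as the family `F` of `k`-sets of color `true`;
an `n`-set `S` is homogeneous for `F` when `F` contains all the `k`-subsets of `S` or none. -/
theorem avoids_of_two_mul_choose_lt {N n k : ℕ} (h : 2 * N.choose n < 2 ^ n.choose k) :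
    Avoids N n k := by
  classical
  set P := (Finset.range N).powersetCard k with hP
  set A : Finset ℕ → Finset (Finset ℕ) := fun S => S.powersetCard k with hA
  set bad : Finset ℕ → Finset (Finset (Finset ℕ)) :=
    fun S => Finset.Icc (A S) P ∪ (P \ A S).powerset with hbad
  have hAP : ∀ S ∈ (Finset.range N).powersetCard n, A S ⊆ P ∧ (A S).card = n.choose k := by
    intro S hS
    rw [Finset.mem_powersetCard] at hS
    exact ⟨Finset.powersetCard_mono hS.1, by simp [hA, hS.2]⟩
  have hcard : (((Finset.range N).powersetCard n).biUnion bad).card < P.powerset.card := by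
    by_cases hne : ((Finset.range N).powersetCard n).Nonempty
    swap
    · rw [Finset.not_nonempty_iff_eq_empty.mp hne]
      simp
    obtain ⟨S₀, hS₀⟩ := hne
    have hle : n.choose k ≤ P.card := (hAP S₀ hS₀).2 ▸ Finset.card_le_card (hAP S₀ hS₀).1
    calc _ ≤ ((Finset.range N).powersetCard n).card * (2 * 2 ^ (P.card - n.choose k)) := by
          refine Finset.card_biUnion_le_card_mul _ _ _ fun S hS => ?_
          refine (Finset.card_union_le _ _).trans ?_
          rw [Finset.card_Icc_finset (hAP S hS).1, Finset.card_powerset,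
            Finset.card_sdiff_of_subset (hAP S hS).1, (hAP S hS).2, two_mul]
      _ = (2 * N.choose n) * 2 ^ (P.card - n.choose k) := by
          rw [Finset.card_powersetCard, Finset.card_range]; ring
      _ < 2 ^ n.choose k * 2 ^ (P.card - n.choose k) := by gcongr
      _ = P.powerset.card := by
          rw [← pow_add, Finset.card_powerset, Nat.add_sub_cancel' hle]
  obtain ⟨F, hFP, hF⟩ := Finset.exists_mem_notMem_of_card_lt_card hcard
  rw [Finset.mem_powerset] at hFP
  refine ⟨fun e => decide (e ∈ F), fun S hS hSn b => ?_⟩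
  have hS' : S ∈ (Finset.range N).powersetCard n := Finset.mem_powersetCard.mpr ⟨hS, hSn⟩
  have hFb : F ∉ bad S := fun hmem => hF (Finset.mem_biUnion.mpr ⟨S, hS', hmem⟩)
  simp only [hbad, Finset.mem_union, Finset.mem_Icc, Finset.mem_powerset, not_or] at hFb
  by_contra! hcon
  cases b with
  | true =>
    refine hFb.1 ⟨fun e he => ?_, hFP⟩
    rw [hA, Finset.mem_powersetCard] at he
    simpa using hcon e he.1 he.2
  | false =>
    refine hFb.2 fun e he => Finset.mem_sdiff.mpr ⟨hFP he, fun heA => ?_⟩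
    rw [hA, Finset.mem_powersetCard] at heA
    simpa [he] using hcon e heA.1 heA.2

theorem avoids_two_pow {t n k : ℕ} (hn : 3 ≤ n) (ht : t * n ≤ n.choose k) :
    Avoids (2 ^ t) n k := by
  apply avoids_of_two_mul_choose_lt
  have h1 : 2 < n.factorial :=
    lt_of_lt_of_le (by decide : 2 < Nat.factorial 3) (Nat.factorial_le hn)
  have h2 : (2 ^ t).choose n * n.factorial ≤ 2 ^ (t * n) := by
    rw [mul_comm, ← Nat.descFactorial_eq_factorial_mul_choose, pow_mul]
    exact Nat.descFactorial_le_pow _ _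
  have h3 : 2 ^ (t * n) ≤ 2 ^ n.choose k := Nat.pow_le_pow_right (by norm_num) ht
  have h4 : 0 < 2 ^ n.choose k := by positivity
  rcases Nat.eq_zero_or_pos ((2 ^ t).choose n) with h0 | h0
  · rw [h0]; simp
  · nlinarith

/-! ### The highest differing binary digit -/

/-- The position of the highest binary digit in which `a` and `b` differ, for `a ≠ b`: the least `d`
such that `a` and `b` agree in all the digits above position `d`. -/
noncomputable def delta (a b : ℕ) : ℕ := sInf {d | a / 2 ^ (d + 1) = b / 2 ^ (d + 1)}

theorem delta_le_iff {a b d : ℕ} : delta a b ≤ d ↔ a / 2 ^ (d + 1) = b / 2 ^ (d + 1) := by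
  have hne : {d | a / 2 ^ (d + 1) = b / 2 ^ (d + 1)}.Nonempty := by
    refine ⟨a + b, ?_⟩
    have h : a + b + 1 < 2 ^ (a + b + 1) := Nat.lt_two_pow_self
    rw [Set.mem_ofPred_eq, Nat.div_eq_of_lt (by omega), Nat.div_eq_of_lt (by omega)]
  refine ⟨fun h => ?_, fun h => Nat.sInf_le h⟩
  have h0 : a / 2 ^ (delta a b + 1) = b / 2 ^ (delta a b + 1) := Nat.sInf_mem hne
  obtain ⟨c, rfl⟩ := Nat.exists_eq_add_of_le h
  rw [show delta a b + c + 1 = (delta a b + 1) + c by ring, pow_add, ← Nat.div_div_eq_div_mul,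
    ← Nat.div_div_eq_div_mul, h0]

theorem delta_lt {a b N : ℕ} (hab : a < b) (hb : b < 2 ^ N) : delta a b < N := by
  rcases N with _ | N
  · simp at hb; omega
  · exact Nat.lt_succ_of_le (delta_le_iff.mpr
      (by rw [Nat.div_eq_of_lt hb, Nat.div_eq_of_lt (hab.trans hb)]))

theorem delta_mono {a a' b' b : ℕ} (h1 : a ≤ a') (h2 : a' ≤ b') (h3 : b' ≤ b) :
    delta a' b' ≤ delta a b := by
  have h : a / 2 ^ (delta a b + 1) = b / 2 ^ (delta a b + 1) := delta_le_iff.mp le_rfl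
  rw [delta_le_iff]
  have i1 := Nat.div_le_div_right (c := 2 ^ (delta a b + 1)) h1
  have i2 := Nat.div_le_div_right (c := 2 ^ (delta a b + 1)) h2
  have i3 := Nat.div_le_div_right (c := 2 ^ (delta a b + 1)) h3
  omega

theorem div_two_pow_delta_lt {a b : ℕ} (h : a < b) :
    a / 2 ^ delta a b < b / 2 ^ delta a b := by
  refine lt_of_le_of_ne (Nat.div_le_div_right h.le) fun heq => ?_
  rcases hd : delta a b with _ | d
  · rw [hd] at heq; simp at heq; omega
  · rw [hd] at heq
    have := delta_le_iff.mpr heq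
    omega

/-- Digit `delta a b` changes from `0` to `1` between `a` and `b`, so it cannot change again in the
same way between `b` and `c` while the higher digits stay fixed. -/
theorem delta_ne {a b c : ℕ} (hab : a < b) (hbc : b < c) : delta a b ≠ delta b c := by
  intro h
  have h1 := div_two_pow_delta_lt hab
  have h2 := div_two_pow_delta_lt hbc
  have h3 : a / 2 ^ (delta a b + 1) = b / 2 ^ (delta a b + 1) := delta_le_iff.mp le_rfl
  have h4 : b / 2 ^ (delta b c + 1) = c / 2 ^ (delta b c + 1) := delta_le_iff.mp le_rfl
  rw [← h] at h2 h4
  rw [pow_succ, ← Nat.div_div_eq_div_mul, ← Nat.div_div_eq_div_mul] at h3 h4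
  omega

theorem delta_le_of_forall {v : ℕ → ℕ} {i j D : ℕ} (hij : i ≤ j)
    (h : ∀ t, i ≤ t → t < j → delta (v t) (v (t + 1)) ≤ D) : delta (v i) (v j) ≤ D := by
  rw [delta_le_iff]
  induction j, hij using Nat.le_induction with
  | base => rfl
  | succ j hij ih =>
    exact (ih fun t h1 h2 => h t h1 (by omega)).trans (delta_le_iff.mp (h j hij (by omega)))

/-- The delta of two members of an increasing sequence is the largest of the consecutive deltas
between them. -/
theorem delta_eq_of_forall_le {v : ℕ → ℕ} {i s j m : ℕ} (hv : StrictMonoOn v (Set.Iio m))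
    (his : i ≤ s) (hsj : s < j) (hjm : j < m)
    (h : ∀ t, i ≤ t → t < j → delta (v t) (v (t + 1)) ≤ delta (v s) (v (s + 1))) :
    delta (v i) (v j) = delta (v s) (v (s + 1)) := by
  refine le_antisymm (delta_le_of_forall (by omega) h) (delta_mono ?_ ?_ ?_) <;>
    exact hv.monotoneOn (by simp; omega) (by simp; omega) (by omega)

/-! ### Increasing enumerations -/

theorem nth_image_range {f : ℕ → ℕ} {m i : ℕ} (hf : StrictMonoOn f (Set.Iio m)) (hi : i < m) :
    Nat.nth (· ∈ (Finset.range m).image f) i = f i := by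
  have hcount : Nat.count (· ∈ (Finset.range m).image f) (f i) = i := by
    rw [Nat.count_eq_card_filter_range]
    have : (Finset.range (f i)).filter (· ∈ (Finset.range m).image f) =
        (Finset.range i).image f := by
      ext x
      simp only [Finset.mem_filter, Finset.mem_range, Finset.mem_image]
      constructor
      · rintro ⟨hx, j, hj, rfl⟩
        exact ⟨j, (hf.lt_iff_lt (by simpa using hj) (by simpa using hi)).mp hx, rfl⟩
      · rintro ⟨j, hj, rfl⟩
        exact ⟨hf (by simp; omega) (by simpa using hi) hj, j, by omega, rfl⟩
    rw [this, Finset.card_image_of_injOn, Finset.card_range]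
    exact hf.injOn.mono (by intro x; simp; omega)
  conv_lhs => rw [← hcount]
  exact Nat.nth_count (p := (· ∈ (Finset.range m).image f))
    (Finset.mem_image_of_mem f (Finset.mem_range.mpr hi))

theorem exists_enumeration (T : Finset ℕ) : ∃ f : ℕ → ℕ, StrictMonoOn f (Set.Iio T.card) ∧
    (Finset.range T.card).image f = T := by
  have hfin : {x | x ∈ T}.Finite := T.finite_toSet
  have hT : hfin.toFinset = T := by ext; simp
  refine ⟨Nat.nth (· ∈ T), ?_, ?_⟩
  · have := Nat.nth_strictMonoOn hfin
    rwa [hT] at this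
  · have := Nat.image_nth_Iio_card hfin
    rw [hT] at this
    apply Finset.coe_injective
    simpa using this

/-! ### Turns of binary words -/

/-- The first turn of the word `u 0, …, u (K - 1)` is between the positions `p` and `p + 1`. -/
def IsTurn (u : ℕ → Bool) (K p : ℕ) : Prop :=
  p + 1 < K ∧ (∀ q ≤ p, u q = u 0) ∧ u (p + 1) ≠ u 0

/-- The color of a word whose first turn is after position `p`. The parity of `p` makes the color
change when a window slides along a word by one place and its first turn stays the same. -/
def turnColor (u : ℕ → Bool) (p : ℕ) : Bool := xor (u 0) (decide (Odd p))

theorem IsTurn.eq {u u' : ℕ → Bool} {K p p' : ℕ} (h : IsTurn u K p) (h' : IsTurn u' K p')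
    (huu : ∀ i < K, u i = u' i) : p = p' := by
  obtain ⟨h1, h2, h3⟩ := h
  obtain ⟨h1', h2', h3'⟩ := h'
  rcases lt_trichotomy p p' with hlt | heq | hlt
  · have := h2' (p + 1) hlt
    rw [← huu _ h1, ← huu 0 (by omega)] at this
    exact (h3 this).elim
  · exact heq
  · have := h2 (p' + 1) hlt
    rw [huu _ h1', huu 0 (by omega)] at this
    exact (h3' this).elim

theorem IsTurn.congr {u u' : ℕ → Bool} {K p : ℕ} (h : IsTurn u K p)
    (huu : ∀ i < K, u i = u' i) : IsTurn u' K p := by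
  obtain ⟨h1, h2, h3⟩ := h
  refine ⟨h1, fun q hq => ?_, ?_⟩
  · rw [← huu q (by omega), ← huu 0 (by omega), h2 q hq]
  · rwa [← huu _ h1, ← huu 0 (by omega)]

theorem exists_isTurn {u : ℕ → Bool} {K : ℕ} (h : ∃ i < K, u i ≠ u 0) : ∃ p, IsTurn u K p := by
  classical
  have hK := (Nat.find_spec h).1
  have hne := (Nat.find_spec h).2
  have hmin := fun m => Nat.find_min h (m := m)
  rcases hp : Nat.find h with _ | p
  · rw [hp] at hne; exact (hne rfl).elim
  · rw [hp] at hK hne hmin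
    refine ⟨p, hK, fun q hq => ?_, hne⟩
    by_contra hq'
    exact hmin q (by omega) ⟨by omega, hq'⟩

/-- Whenever all nonconstant windows of length `K` in a word of length `M` have the same color, the
word has a constant run of length `r`. -/
def ForcesRun (K M r : ℕ) : Prop :=
  ∀ (u : ℕ → Bool) (c : Bool),
    (∀ s p, s + K ≤ M → IsTurn (fun i => u (s + i)) K p →
      turnColor (fun i => u (s + i)) p = c) →
    ∃ a, a + r ≤ M ∧ ∀ i < r, u (a + i) = u a

/-- In windows of length `2` the color is the letter before the turn. Consecutive turns have
different letters before them, so there is at most one turn. -/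
theorem forcesRun_two (r : ℕ) : ForcesRun 2 (2 * r) r := by
  intro u c h
  have key : ∀ s, s + 2 ≤ 2 * r → u s ≠ u (s + 1) → u s = c := by
    intro s hs hne
    simpa [turnColor] using h s 0 hs ⟨by norm_num, by simp, by simpa using hne.symm⟩
  by_cases hc : ∀ i < r, u i = u 0
  · exact ⟨0, by omega, by simpa using hc⟩
  push Not at hc
  obtain ⟨p, hp, hpc, hpn⟩ := exists_isTurn hc
  have hpc' : u p = c := key p (by omega) (by rw [hpc p le_rfl]; exact hpn.symm)
  have hrun : ∀ i, p + 1 + i < 2 * r → u (p + 1 + i) = !c := by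
    intro i hi
    induction i with
    | zero =>
      rw [hpc p le_rfl] at hpc'
      rw [hpc'] at hpn
      simpa using Bool.eq_not.mpr hpn
    | succ i ih =>
      by_contra hne
      have h1 := ih (by omega)
      have := key (p + 1 + i) (by omega) (by rw [h1]; exact fun h => hne h.symm)
      rw [h1] at this
      simp at this
  exact ⟨p + 1, by omega, fun i hi => by
    rw [hrun i (by omega), ← hrun 0 (by omega), add_zero]⟩

/-- If all nonconstant windows have the same color `c`, the word is constant except possibly for its
first and its last letter, and an exceptional first letter is `c`. -/
theorem run_of_turnColor_eq {u : ℕ → Bool} {c : Bool} {K M : ℕ} (hK : 3 ≤ K) (hM : K + 2 ≤ M)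
    (h : ∀ s p, s + K ≤ M → IsTurn (fun i => u (s + i)) K p →
      turnColor (fun i => u (s + i)) p = c) :
    (∀ i, 1 ≤ i → i + 1 < M → u i = u 1) ∧ (u 0 = u 1 ∨ u 0 = c) := by
  -- A window that can be moved forward either turns at once or is constant.
  have hstart : ∀ s, s + K < M → u s = u (s + 1) → ∀ i < K, u (s + i) = u s := by
    intro s hs hs1
    by_contra! hcon
    obtain ⟨p, hp, hpc, hpn⟩ := exists_isTurn (u := fun i => u (s + i)) (K := K)
      (by simpa using hcon)
    rcases p with _ | p
    · exact hpn (by simpa using hs1.symm)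
    · have e1 := h s (p + 1) (by omega) ⟨hp, hpc, hpn⟩
      have e2 := h (s + 1) p (by omega) ⟨by omega, fun q hq => ?_, ?_⟩
      · simp only [turnColor, add_zero, ← hs1, Nat.odd_add_one] at e1 e2
        rw [← e2] at e1
        revert e1
        cases u s <;> by_cases ho : Odd p <;> simp [ho]
      · have := hpc (q + 1) (by omega)
        simp only [add_zero] at this ⊢
        rw [← hs1, ← this]
        congr 1
        ring
      · simp only [add_zero, ← hs1] at hpn ⊢
        rwa [show s + 1 + (p + 1) = s + (p + 1 + 1) by ring]
  have hturn0 : ∀ s, s + K ≤ M → u s ≠ u (s + 1) → u s = c := by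
    intro s hs hne
    simpa [turnColor] using h s 0 hs ⟨by omega, by simp, by simpa using hne.symm⟩
  -- Turns right after the positions `0` and `1` would give windows of different colors.
  have h12 : u 1 = u 2 := by
    by_contra h12
    have e1 := hturn0 1 (by omega) h12
    by_cases h01 : u 0 = u 1
    · have := hstart 0 (by omega) h01 2 (by omega)
      simp only [zero_add] at this
      exact h12 (by rw [this, h01])
    · exact h01 ((hturn0 0 (by omega) h01).trans e1.symm)
  have hall : ∀ s, 1 ≤ s → s + K < M → u s = u 1 ∧ u s = u (s + 1) := by
    intro s hs
    induction s, hs using Nat.le_induction with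
    | base => exact fun _ => ⟨rfl, h12⟩
    | succ s hs ih =>
      intro hsM
      obtain ⟨i1, i2⟩ := ih (by omega)
      have := hstart s (by omega) i2 2 (by omega)
      exact ⟨i2 ▸ i1, by rw [← i2, ← this]⟩
  refine ⟨fun i hi hiM => ?_, ?_⟩
  · by_cases hiK : i + K < M
    · exact (hall i hi hiK).1
    · have hs := hall (M - K - 1) (by omega) (by omega)
      have := hstart (M - K - 1) (by omega) hs.2 (i - (M - K - 1)) (by omega)
      rw [← hs.1, ← this]
      congr 1
      omega
  · by_cases h01 : u 0 = u 1
    · exact Or.inl h01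
    · exact Or.inr (hturn0 0 (by omega) h01)

theorem forcesRun_sub_two {K M : ℕ} (hK : 3 ≤ K) (hM : K + 2 ≤ M) : ForcesRun K M (M - 2) := by
  intro u c h
  exact ⟨1, by omega, fun i hi => (run_of_turnColor_eq hK hM h).1 _ (by omega) (by omega)⟩

/-- If both end letters were exceptional, the first window would turn after position `0` and the last
one after position `K - 2`, which is even, so their colors would be the two different letters. -/
theorem forcesRun_sub_one {K M : ℕ} (hK : 3 ≤ K) (hKe : Even K) (hM : K + 2 ≤ M) :
    ForcesRun K M (M - 1) := by
  intro u c h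
  obtain ⟨hmid, h0⟩ := run_of_turnColor_eq hK hM h
  by_cases h01 : u 0 = u 1
  · refine ⟨0, by omega, fun i hi => ?_⟩
    rcases i with _ | i
    · rfl
    · rw [zero_add, hmid (i + 1) (by omega) (by omega), h01]
  by_cases hlast : u (M - 1) = u 1
  · refine ⟨1, by omega, fun i hi => ?_⟩
    by_cases hi' : 1 + i = M - 1
    · rw [hi', hlast]
    · exact hmid _ (by omega) (by omega)
  exfalso
  have hodd : ¬ Odd (K - 2) := by
    rw [Nat.not_odd_iff_even]
    exact (Nat.even_sub (by omega)).mpr (by simp [hKe])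
  have hfirst : u (M - K) = u 1 := hmid _ (by omega) (by omega)
  have := h (M - K) (K - 2) (by omega) ⟨by omega, fun q hq => ?_, ?_⟩
  · simp only [turnColor, add_zero, hfirst, hodd] at this
    have h0c := h0.resolve_left h01
    simp at this
    exact h01 (h0c.trans this.symm)
  · simp only [add_zero, hfirst]
    exact hmid _ (by omega) (by omega)
  · simp only [add_zero, hfirst]
    rwa [show M - K + (K - 2 + 1) = M - 1 by omega]

/-! ### The stepping-up coloring -/

/-- The word of a sequence: whether the consecutive deltas go up at place `i`. -/
noncomputable def stepWord (x : ℕ → ℕ) (i : ℕ) : Bool :=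
  decide (delta (x i) (x (i + 1)) < delta (x (i + 1)) (x (i + 2)))

theorem stepWord_congr {x y : ℕ → ℕ} {K : ℕ} (h : ∀ i < K + 2, x i = y i) :
    ∀ i < K, stepWord x i = stepWord y i := by
  intro i hi
  simp only [stepWord, h i (by omega), h (i + 1) (by omega), h (i + 2) (by omega)]

open Classical in
/-- The color of the increasing sequence `x 0, …, x (K + 1)`, whose word has length `K`: it is read
off the first turn of the word, or is the color under `χ` of the set of the `K + 1` deltas if the
word is constant. -/
noncomputable def sequenceColor (χ : Finset ℕ → Bool) (K : ℕ) (x : ℕ → ℕ) : Bool :=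
  if h : ∃ p, IsTurn (stepWord x) K p then turnColor (stepWord x) h.choose
  else χ ((Finset.range (K + 1)).image fun i => delta (x i) (x (i + 1)))

theorem sequenceColor_of_isTurn {χ : Finset ℕ → Bool} {K p : ℕ} {x : ℕ → ℕ}
    (h : IsTurn (stepWord x) K p) : sequenceColor χ K x = turnColor (stepWord x) p := by
  have hex : ∃ p, IsTurn (stepWord x) K p := ⟨p, h⟩
  rw [sequenceColor, dif_pos hex, hex.choose_spec.eq h fun _ _ => rfl]

theorem sequenceColor_of_forall_eq {χ : Finset ℕ → Bool} {K : ℕ} {x : ℕ → ℕ}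
    (h : ∀ i < K, stepWord x i = stepWord x 0) : sequenceColor χ K x =
      χ ((Finset.range (K + 1)).image fun i => delta (x i) (x (i + 1))) := by
  rw [sequenceColor, dif_neg]
  rintro ⟨p, hp, -, hne⟩
  exact hne (h _ hp)

theorem sequenceColor_congr {χ : Finset ℕ → Bool} {K : ℕ} {x y : ℕ → ℕ}
    (h : ∀ i < K + 2, x i = y i) : sequenceColor χ K x = sequenceColor χ K y := by
  by_cases hex : ∃ i < K, stepWord x i ≠ stepWord x 0
  · obtain ⟨p, hp⟩ := exists_isTurn hex
    have hK := hp.1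
    rw [sequenceColor_of_isTurn hp, sequenceColor_of_isTurn (hp.congr (stepWord_congr h)),
      turnColor, turnColor, stepWord_congr h 0 (by omega)]
  · push Not at hex
    rw [sequenceColor_of_forall_eq hex, sequenceColor_of_forall_eq]
    · congr 1
      refine Finset.image_congr fun i hi => ?_
      simp only [Finset.coe_range, Set.mem_Iio] at hi
      simp only [h i (by omega), h (i + 1) (by omega)]
    · intro i hi
      rw [← stepWord_congr h i hi, ← stepWord_congr h 0 (by omega), hex i hi]

/-- The stepped-up coloring of the `(K + 2)`-sets, through their increasing enumeration. -/
noncomputable def stepUpColor (χ : Finset ℕ → Bool) (K : ℕ) (e : Finset ℕ) : Bool :=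
  sequenceColor χ K (Nat.nth (· ∈ e))

theorem stepUpColor_image_range {χ : Finset ℕ → Bool} {K : ℕ} {x : ℕ → ℕ}
    (hx : StrictMonoOn x (Set.Iio (K + 2))) :
    stepUpColor χ K ((Finset.range (K + 2)).image x) = sequenceColor χ K x :=
  sequenceColor_congr fun _ hi => nth_image_range hx hi

theorem card_image_range {x : ℕ → ℕ} {m : ℕ} (hx : StrictMonoOn x (Set.Iio m)) :
    ((Finset.range m).image x).card = m := by
  rw [Finset.card_image_of_injOn, Finset.card_range]
  simpa using hx.injOn

/-- Along a run of monotone deltas, every `(K + 1)`-set of deltas is the set of consecutive deltas of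
some `(K + 2)`-set with constant word. -/
theorem exists_lift_of_monotone {v : ℕ → ℕ} {m a r K : ℕ} {I : Finset ℕ}
    (hv : StrictMonoOn v (Set.Iio m)) (ham : a + r + 1 < m)
    (hI : I ⊆ Finset.Ico a (a + r + 1)) (hIcard : I.card = K + 1)
    (hd : (∀ i j, a ≤ i → i < j → j < a + r + 1 →
        delta (v i) (v (i + 1)) < delta (v j) (v (j + 1))) ∨
      (∀ i j, a ≤ i → i < j → j < a + r + 1 →
        delta (v j) (v (j + 1)) < delta (v i) (v (i + 1)))) :
    ∃ x : ℕ → ℕ, StrictMonoOn x (Set.Iio (K + 2)) ∧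
      (Finset.range (K + 2)).image x ⊆ (Finset.range m).image v ∧
      (∀ i < K, stepWord x i = stepWord x 0) ∧
      ((Finset.range (K + 1)).image fun i => delta (x i) (x (i + 1))) =
        I.image fun i => delta (v i) (v (i + 1)) := by
  obtain ⟨w, hw, hwI⟩ := exists_enumeration I
  rw [hIcard] at hw hwI
  have hwmem : ∀ i < K + 1, a ≤ w i ∧ w i < a + r + 1 := by
    intro i hi
    have : w i ∈ I := hwI ▸ Finset.mem_image_of_mem w (Finset.mem_range.mpr hi)
    simpa using hI this
  have hwlt : ∀ i j, i < j → j < K + 1 → w i < w j := fun i j hij hj =>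
    hw (by simp; omega) (by simpa using hj) hij
  -- It suffices to have a sequence of indices whose deltas are those at the `w i`.
  suffices ∃ y : ℕ → ℕ, StrictMonoOn y (Set.Iio (K + 2)) ∧ (∀ i < K + 2, y i < m) ∧
      ∀ i < K + 1, delta (v (y i)) (v (y (i + 1))) = delta (v (w i)) (v (w i + 1)) by
    obtain ⟨y, hy, hym, hyd⟩ := this
    refine ⟨v ∘ y, ?_, ?_, ?_, ?_⟩
    · exact hv.comp hy fun i hi => hym i hi
    · rw [Finset.image_subset_iff]
      intro i hi
      exact Finset.mem_image_of_mem v (Finset.mem_range.mpr (hym i (Finset.mem_range.mp hi)))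
    · have hs : ∀ i < K, stepWord (v ∘ y) i =
          decide (delta (v (w i)) (v (w i + 1)) < delta (v (w (i + 1))) (v (w (i + 1) + 1))) := by
        intro i hi
        simp only [stepWord, Function.comp_apply, hyd i (by omega)]
        rw [← hyd (i + 1) (by omega)]
      intro i hi
      have hlt := fun j (hj : j < K) => hwlt j (j + 1) (by omega) (by omega)
      have hm := fun j (hj : j < K + 1) => hwmem j hj
      rw [hs i hi, hs 0 (by omega)]
      rcases hd with hd | hd
      · rw [decide_eq_true (hd _ _ (hm i (by omega)).1 (hlt i hi) (hm (i + 1) (by omega)).2),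
          decide_eq_true (hd _ _ (hm 0 (by omega)).1 (hlt 0 (by omega)) (hm 1 (by omega)).2)]
      · rw [decide_eq_false
            (hd _ _ (hm i (by omega)).1 (hlt i hi) (hm (i + 1) (by omega)).2).not_gt,
          decide_eq_false
            (hd _ _ (hm 0 (by omega)).1 (hlt 0 (by omega)) (hm 1 (by omega)).2).not_gt]
    · rw [← hwI, Finset.image_image]
      refine Finset.image_congr fun i hi => ?_
      exact hyd i (by simpa using hi)
  -- For increasing deltas, take the right ends of the chosen gaps, preceded by the start of the
  -- run; for decreasing ones, take the left ends, followed by the end of the run.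
  rcases hd with hd | hd
  · refine ⟨fun i => if i = 0 then a else w (i - 1) + 1, ?_, ?_, ?_⟩
    · intro i hi j hj hij
      simp only [Set.mem_Iio] at hi hj
      have hj0 : j ≠ 0 := by omega
      simp only [hj0, if_false]
      split_ifs with hi0
      · have := (hwmem (j - 1) (by omega)).1
        omega
      · have := hwlt (i - 1) (j - 1) (by omega) (by omega)
        omega
    · intro i hi
      dsimp only
      split_ifs with hi0
      · omega
      · have := (hwmem (i - 1) (by omega)).2
        omega
    · intro i hi
      have hwi := hwmem i hi
      have hle : (if i = 0 then a else w (i - 1) + 1) ≤ w i ∧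
          a ≤ if i = 0 then a else w (i - 1) + 1 := by
        split_ifs with hi0
        · exact ⟨hwi.1, le_rfl⟩
        · have h1 := hwlt (i - 1) i (by omega) hi
          have h2 := (hwmem (i - 1) (by omega)).1
          omega
      simp only [Nat.add_eq_zero_iff, one_ne_zero, and_false, if_false, Nat.add_sub_cancel]
      refine delta_eq_of_forall_le hv hle.1 (by omega) (by omega) fun t ht htj => ?_
      rcases Nat.lt_succ_iff_lt_or_eq.mp htj with hlt | rfl
      · exact (hd t (w i) (by omega) hlt hwi.2).le
      · exact le_rfl
  · refine ⟨fun i => if i = K + 1 then a + r + 1 else w i, ?_, ?_, ?_⟩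
    · intro i hi j hj hij
      simp only [Set.mem_Iio] at hi hj
      have hi0 : i ≠ K + 1 := by omega
      simp only [hi0, if_false]
      split_ifs with hj0
      · exact (hwmem i (by omega)).2
      · exact hwlt i j (by omega) (by omega)
    · intro i hi
      dsimp only
      split_ifs with hi0
      · omega
      · have := (hwmem i (by omega)).2
        omega
    · intro i hi
      have hwi := hwmem i hi
      have hle : w i < (if i + 1 = K + 1 then a + r + 1 else w (i + 1)) ∧
          (if i + 1 = K + 1 then a + r + 1 else w (i + 1)) ≤ a + r + 1 := by
        split_ifs with hi0
        · exact ⟨hwi.2, le_rfl⟩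
        · have h1 := hwlt i (i + 1) (by omega) (by omega)
          have h2 := (hwmem (i + 1) (by omega)).2
          omega
      have hiK : i ≠ K + 1 := by omega
      simp only [hiK, if_false]
      refine delta_eq_of_forall_le hv le_rfl hle.1 (by omega) fun t ht htj => ?_
      rcases ht.lt_or_eq with hlt | rfl
      · exact (hd (w i) t hwi.1 hlt (by omega)).le
      · exact le_rfl

/-- The stepping-up lemma. The loss in the size of the homogeneous set depends only on how long a
constant run is forced in words of length `M`. -/
theorem Avoids.stepUp {N r K M : ℕ} (h : Avoids N (r + 1) (K + 1)) (hrun : ForcesRun K M r) :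
    Avoids (2 ^ N) (M + 2) (K + 2) := by
  obtain ⟨χ, hχ⟩ := h
  refine ⟨stepUpColor χ K, fun S hS hScard b => ?_⟩
  by_contra! hcon
  obtain ⟨v, hv, hvS⟩ := exists_enumeration S
  rw [hScard] at hv hvS
  subst hvS
  have hlt : ∀ i j, i < j → j < M + 2 → v i < v j := fun i j hij hj =>
    hv (by simp; omega) (by simpa using hj) hij
  -- The windows of the word of `S` belong to sets of consecutive elements of `S`.
  obtain ⟨a, haM, ha⟩ := hrun (stepWord v) b (by
    intro s p hs hp
    have hx : StrictMonoOn (fun i => v (s + i)) (Set.Iio (K + 2)) := by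
      intro i hi j hj hij
      simp only [Set.mem_Iio] at hi hj
      exact hlt _ _ (by omega) (by omega)
    have hw : stepWord (fun i => v (s + i)) = fun i => stepWord v (s + i) := by
      funext i
      simp only [stepWord, add_assoc]
    rw [← hw] at hp ⊢
    rw [← sequenceColor_of_isTurn (χ := χ) hp, ← stepUpColor_image_range hx]
    refine hcon _ ?_ (card_image_range hx)
    rw [Finset.image_subset_iff]
    intro i hi
    rw [Finset.mem_range] at hi
    exact Finset.mem_image_of_mem v (Finset.mem_range.mpr (by omega)))
  set d : ℕ → ℕ := fun i => delta (v i) (v (i + 1)) with hd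
  have hmono : (∀ i j, a ≤ i → i < j → j < a + r + 1 → d i < d j) ∨
      (∀ i j, a ≤ i → i < j → j < a + r + 1 → d j < d i) := by
    have hstep : ∀ i, a ≤ i → i < a + r → stepWord v i = stepWord v a := by
      intro i hai hi
      have := ha (i - a) (by omega)
      rwa [Nat.add_sub_cancel' hai] at this
    cases hu : stepWord v a with
    | true =>
      left
      intro i j hai hij
      induction j, hij using Nat.le_induction with
      | base =>
        intro hj
        have := hstep i hai (by omega)
        rw [hu] at this
        simpa [stepWord] using this
      | succ j hij ih =>
        intro hj
        have := hstep j (by omega) (by omega)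
        rw [hu] at this
        exact (ih (by omega)).trans (by simpa [stepWord] using this)
    | false =>
      right
      have hlt' : ∀ j, a ≤ j → j + 1 < a + r + 1 → d (j + 1) < d j := by
        intro j haj hj
        have := hstep j haj (by omega)
        rw [hu] at this
        have hle : d (j + 1) ≤ d j := by simpa [stepWord] using this
        exact lt_of_le_of_ne hle
          (delta_ne (hlt j (j + 1) (by omega) (by omega))
            (hlt (j + 1) (j + 2) (by omega) (by omega))).symm
      intro i j hai hij
      induction j, hij using Nat.le_induction with
      | base => exact fun hj => hlt' i hai hj
      | succ j hij ih => exact fun hj => (hlt' j (by omega) hj).trans (ih (by omega))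
  have hinj : Set.InjOn d (Finset.Ico a (a + r + 1)) := by
    intro i hi j hj hij
    simp only [Finset.coe_Ico, Set.mem_Ico] at hi hj
    rcases lt_trichotomy i j with h | h | h
    · rcases hmono with hm | hm
      · exact absurd hij (hm i j hi.1 h hj.2).ne
      · exact absurd hij (hm i j hi.1 h hj.2).ne'
    · exact h
    · rcases hmono with hm | hm
      · exact absurd hij (hm j i hj.1 h hi.2).ne'
      · exact absurd hij (hm j i hj.1 h hi.2).ne
  obtain ⟨e, heD, hecard, hne⟩ := hχ ((Finset.Ico a (a + r + 1)).image d) (by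
      rw [Finset.image_subset_iff]
      intro i hi
      simp only [Finset.mem_Ico] at hi
      refine Finset.mem_range.mpr (delta_lt (hlt i (i + 1) (by omega) (by omega)) ?_)
      exact Finset.mem_range.mp (hS (Finset.mem_image_of_mem v
        (Finset.mem_range.mpr (by omega)))))
    (by rw [Finset.card_image_of_injOn hinj, Nat.card_Ico]; omega) b
  obtain ⟨I, hI, rfl⟩ := Finset.subset_image_iff.mp heD
  have hI' : I ⊆ Finset.Ico a (a + r + 1) := by exact_mod_cast hI
  rw [Finset.card_image_of_injOn (hinj.mono (by exact_mod_cast hI'))] at hecard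
  obtain ⟨x, hx, hxS, hxw, hxI⟩ :=
    exists_lift_of_monotone hv (by omega) hI' hecard hmono
  refine hne ?_
  rw [← hcon _ hxS (card_image_range hx), stepUpColor_image_range hx,
    sequenceColor_of_forall_eq hxw, hxI]

/-! ### Ramsey numbers -/

theorem exists_arrows (k n : ℕ) : ∃ N, Arrows N n k 2 := by
  obtain ⟨N, hN⟩ := exists_bound_ramsey k n n
  refine ⟨N, fun χ => ?_⟩
  rcases hN (Fin N) Finset.univ (by simp) (fun e => ∃ h : e.card = k, χ ⟨e, h⟩ = 0) with
    ⟨S, -, hS, h⟩ | ⟨S, -, hS, h⟩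
  · exact ⟨S, hS, 0, fun e he => (h e.1 he e.2).2⟩
  · refine ⟨S, hS, 1, fun e he => ?_⟩
    have := fun h0 => h e.1 he e.2 ⟨e.2, h0⟩
    exact Fin.eq_one_of_ne_zero _ this

theorem Avoids.not_arrows {N N' n k : ℕ} (h : Avoids N n k) (hN : N' ≤ N) :
    ¬ Arrows N' n k 2 := by
  obtain ⟨χ, hχ⟩ := h
  intro harr
  obtain ⟨S, hS, i, hi⟩ := harr fun e => if χ (e.1.map Fin.valEmbedding) then 1 else 0
  obtain ⟨e, heS, he, hne⟩ := hχ (S.map Fin.valEmbedding) (by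
    intro x hx
    obtain ⟨y, -, rfl⟩ := Finset.mem_map.mp hx
    exact Finset.mem_range.mpr (y.2.trans_le hN)) (by rw [Finset.card_map, hS]) (decide (i = 1))
  obtain ⟨e₀, he₀, rfl⟩ := Finset.subset_map_iff.mp heS
  rw [Finset.card_map] at he
  have := hi ⟨e₀, he⟩ he₀
  apply hne
  rw [← this]
  by_cases hc : χ (e₀.map Fin.valEmbedding) <;> simp [hc]

theorem Avoids.lt_ramseyNumber {N n k : ℕ} (h : Avoids N n k) : N < ramseyNumber k n := by
  by_contra! hle
  exact h.not_arrows hle (Nat.sInf_mem (exists_arrows k n))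

/-! ### Lower bounds -/

theorem tower_succ_le {i N : ℕ} {x : ℝ} (h : tower (i + 1) x ≤ N) :
    tower (i + 2) x ≤ (2 ^ N : ℕ) := by
  push_cast
  rw [tower, ← Real.rpow_natCast]
  exact Real.rpow_le_rpow_of_exponent_le (by norm_num) h

theorem tower_mono {i : ℕ} {x y : ℝ} (h : x ≤ y) : tower i x ≤ tower i y := by
  induction i with
  | zero => exact h
  | succ i ih =>
    cases i with
    | zero => exact h
    | succ i => exact Real.rpow_le_rpow_of_exponent_le (by norm_num) ih

theorem exists_avoids_three {m : ℕ} (hm : 6 ≤ m) :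
    ∃ N : ℕ, tower 2 ((m : ℝ) ^ 2 / 16) ≤ N ∧ Avoids N m 3 := by
  obtain ⟨j, rfl⟩ := Nat.exists_eq_add_of_le' hm
  set q := (j + 5) * (j + 4) with hq
  have hdiv : q < 6 * (q / 6) + 6 := by omega
  have hchoose : 6 * (j + 6).choose 3 = (j + 6) * q := by
    have := Nat.descFactorial_eq_factorial_mul_choose (j + 6) 3
    simp [Nat.descFactorial, Nat.factorial] at this
    rw [← this, hq]
    ring
  refine ⟨2 ^ (q / 6), ?_, avoids_two_pow (by omega) ?_⟩
  · have hreal : ((j + 6 : ℕ) : ℝ) ^ 2 / 16 ≤ (q / 6 : ℕ) := by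
      have h1 : (q : ℝ) + 1 ≤ 6 * (q / 6 : ℕ) + 6 := by exact_mod_cast hdiv
      have h2 : (q : ℝ) = (j + 5) * (j + 4) := by rw [hq]; push_cast; ring
      push_cast
      have hj : (0 : ℝ) ≤ j := Nat.cast_nonneg j
      nlinarith
    exact tower_succ_le (i := 0) hreal
  · have : 6 * (q / 6) ≤ q := Nat.mul_div_le q 6
    nlinarith

theorem exists_avoids_two {n : ℕ} (hn : 6 ≤ n) :
    ∃ N : ℕ, (n : ℝ) ^ 2 / 16 ≤ N ∧ Avoids N n 2 := by
  set t := (n - 1) / 2 with ht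
  refine ⟨2 ^ t, ?_, avoids_two_pow (by omega) ?_⟩
  · have h1 : (t / 2 + 1) ^ 2 ≤ 2 ^ t := calc
      (t / 2 + 1) ^ 2 ≤ (2 ^ (t / 2)) ^ 2 := Nat.pow_le_pow_left Nat.lt_two_pow_self 2
      _ = 2 ^ (t / 2 * 2) := (pow_mul _ _ _).symm
      _ ≤ 2 ^ t := Nat.pow_le_pow_right (by norm_num) (Nat.div_mul_le_self t 2)
    have h2 : n ≤ 4 * (t / 2 + 1) := by omega
    have h3 : n ^ 2 ≤ 16 * 2 ^ t := by nlinarith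
    have h4 : (n : ℝ) ^ 2 ≤ 16 * (2 ^ t : ℕ) := by exact_mod_cast h3
    linarith
  · rw [Nat.choose_two_right, Nat.le_div_iff_mul_le (by norm_num)]
    have : t * 2 ≤ n - 1 := Nat.div_mul_le_self _ _
    nlinarith

/-- Iterated stepping up from triples. The first step doubles the size; the later ones add `3` and
`2` alternately, which makes `(5 * j + 1) / 2`, rounded down, after `j` of them. -/
theorem exists_avoids_of_three {m j : ℕ} {x : ℝ} (hm : 6 ≤ m)
    (h : ∃ N : ℕ, tower 2 x ≤ N ∧ Avoids N m 3) :
    ∃ N : ℕ, tower (j + 3) x ≤ N ∧ Avoids N (2 * m + (5 * j + 1) / 2) (j + 4) := by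
  induction j with
  | zero =>
    obtain ⟨N, hN, hav⟩ := h
    obtain ⟨r, rfl⟩ := Nat.exists_eq_add_of_le' (by omega : 1 ≤ m)
    exact ⟨2 ^ N, tower_succ_le hN, hav.stepUp (K := 2) (forcesRun_two r)⟩
  | succ j ih =>
    obtain ⟨N, hN, hav⟩ := ih
    refine ⟨2 ^ N, tower_succ_le hN, ?_⟩
    obtain ⟨r, hr⟩ := Nat.exists_eq_add_of_le' (by omega : 1 ≤ 2 * m + (5 * j + 1) / 2)
    rw [hr] at hav
    rcases Nat.even_or_odd j with hj | hj
    · have := hav.stepUp (K := j + 3)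
        (forcesRun_sub_two (M := r + 2) (by omega) (by omega))
      convert this using 1
      obtain ⟨i, rfl⟩ := hj
      omega
    · have := hav.stepUp (K := j + 3)
        (forcesRun_sub_one (M := r + 1) (by omega) (hj.add_odd (by decide)) (by omega))
      convert this using 1
      obtain ⟨i, rfl⟩ := hj
      omega

end HypergraphRamsey

theorem mainTheorem5 :
    ∃ c : ℝ, 0 < c ∧ ∀ k n : ℕ, 2 ≤ k → 3 * k ≤ n →
      HypergraphRamsey.tower (k - 1) (c * (n : ℝ) ^ 2) ≤
        (HypergraphRamsey.ramseyNumber k n : ℝ) := by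
  open HypergraphRamsey in
  -- `2304 = 16 * 12 ^ 2`: the bound for triples has the constant `1 / 16`, and is used for sets of
  -- size at least `n / 12`.
  refine ⟨1 / 2304, by norm_num, fun k n hk hn => ?_⟩
  suffices ∃ N : ℕ, tower (k - 1) (1 / 2304 * (n : ℝ) ^ 2) ≤ N ∧ Avoids N n k by
    obtain ⟨N, hN, hav⟩ := this
    exact hN.trans (by exact_mod_cast hav.lt_ramseyNumber.le)
  have hsq : (0 : ℝ) ≤ (n : ℝ) ^ 2 := by positivity
  obtain rfl | rfl | hk4 : k = 2 ∨ k = 3 ∨ 4 ≤ k := by omega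
  · obtain ⟨N, hN, hav⟩ := exists_avoids_two (n := n) (by omega)
    exact ⟨N, (tower_mono (i := 1) (by linarith)).trans hN, hav⟩
  · obtain ⟨N, hN, hav⟩ := exists_avoids_three (m := n) (by omega)
    exact ⟨N, (tower_mono (i := 2) (by linarith)).trans hN, hav⟩
  · obtain ⟨j, rfl⟩ := Nat.exists_eq_add_of_le' hk4
    set m := (n - (5 * j + 1) / 2) / 2 with hm
    obtain ⟨N, hN, hav⟩ := exists_avoids_of_three (j := j) (m := m) (by omega)
      (exists_avoids_three (by omega))
    refine ⟨N, (tower_mono (i := j + 3) ?_).trans hN, hav.mono (by omega)⟩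
    have hnm : (n : ℝ) ≤ 12 * m := by exact_mod_cast (by omega : n ≤ 12 * m)
    have hn0 : (0 : ℝ) ≤ n := Nat.cast_nonneg n
    nlinarith
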